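/- Let $\mathbb K$ be $\mathbb R$ or $\mathbb C$, and let $X=\ell_p(\mathbb Z)$ $(1\le p<\infty)$ or $X=c_0(\mathbb Z)$, the usual Banach space of sequences with entries in $\mathbb K$. Let $w=(w_n)_{n\in\mathbb Z}$ be a bounded sequence in $\mathbb K$ with $\inf_{n\in\mathbb Z}|w_n|>0$, so that the bilateral weighted backward shift $$B_w:(x_n)_{n\in\mathbb Z}\in X\mapsto (w_{n+1}x_{n+1})_{n\in\mathbb Z}\in X$$ is an invertible operator (bounded linear map) on $X$. Definitions. A homeomorphism $h$ of a metric space $(M,d)$ has the shadowing property if for every $\varepsilon>0$ there is $\delta>0$ such that for every sequence $(x_n)_{n\in\mathbb Z}$ in $M$ with $d(h(x_n),x_{n+1})\le\delta$ for all $n\in\mathbb Z$ there is $x\in M$ with $d(x_n,h^n(x))<\varepsilon$ for all $n\in\mathbb Z$. Maps $f,g:X\to X$ are topologically conjugate if $h\circ f=g\circ h$ for some homeomorphism $h:X\to X$. An invertible operator $T$ on $X$ is - structurally stable if there is $\varepsilon>0$ such that $T+\varphi$ is topologically conjugate to $T$ for every bounded Lipschitz map $\varphi:X\to X$ with $\sup_{x}\|\varphi(x)\|\le\varepsilon$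 and Lipschitz constant at most $\varepsilon$; - structurally stable relative to $GL(X)$ if there is $\varepsilon>0$ such that every invertible operator $S$ on $X$ with $\|S-T\|\le\varepsilon$ is topologically conjugate to $T$; - hyperbolic if its spectrum (the spectrum of its complexification, if $\mathbb K=\mathbb R$) does not meet the unit circle. Condition (C) says that the following two limits exist and satisfy $$\lim_{n\to\infty}\sup_{k\ge1}|w_{-k}w_{-k-1}\cdots w_{-k-n}|^{1/n}<1\quad\text{and}\quad \lim_{n\to\infty}\inf_{k\ge1}|w_kw_{k+1}\cdots w_{k+n}|^{1/n}>1 .$$ Theorem. If $B_w$ has the shadowing property, then $B_w$ is structurally stable. If $w$ satisfies condition (C), then $B_w$ is structurally stable, but it is not hyperbolic and it is not structurally stable relative to $GL(X)$. Moreover, for every real $a>1$, the sequence with $w_n=1/a$ for $n<0$ and $w_n=a$ for $n\ge0$ is bounded with $\inf_n|w_n|>0$ and satisfies condition (C); so nonhyperbolic structurally stable operators exist. -/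

import Mathlib

open Filter Topology
open scoped ENNReal NNReal BoundedContinuousFunction ZeroAtInfty TensorProduct

noncomputable section

/-! ### Dynamical notions -/

/-- The shadowing property of a homeomorphism `h` of a metric space: for every `ε > 0` there is
`δ > 0` such that every two-sided `δ`-pseudotrajectory of `h` is `ε`-shadowed by a trajectory.
Here `h ^ n` (`n : ℤ`) is the `n`-th iterate, in the group of homeomorphisms under composition. -/
def HasShadowingProperty {M : Type*} [MetricSpace M] (h : M ≃ₜ M) : Prop :=
  ∀ ε : ℝ, 0 < ε → ∃ δ : ℝ, 0 < δ ∧ ∀ x : ℤ → M,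
    (∀ n : ℤ, dist (h (x n)) (x (n + 1)) ≤ δ) →
      ∃ y : M, ∀ n : ℤ, dist (x n) ((h ^ n) y) < ε

/-- Topological conjugacy of two self-maps `f` and `g` of a topological space. -/
def TopologicallyConjugate {M : Type*} [TopologicalSpace M] (f g : M → M) : Prop :=
  ∃ h : M ≃ₜ M, ∀ x, h (f x) = g (h x)

section Operators

variable {𝕜 X : Type*} [RCLike 𝕜] [NormedAddCommGroup X] [NormedSpace 𝕜 X]

/-- Structural stability of an invertible operator `T`: there is `ε > 0` such that `T + φ` is
topologically conjugate to `T` for every bounded continuous `φ : X → X` whose supremum norm and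
Lipschitz constant are at most `ε`. -/
def StructurallyStable (T : X ≃L[𝕜] X) : Prop :=
  ∃ ε : ℝ≥0, 0 < ε ∧ ∀ φ : X →ᵇ X, ‖φ‖ ≤ ε → LipschitzWith ε φ →
    TopologicallyConjugate (fun x => T x + φ x) T

/-- Structural stability of an invertible operator `T` relative to the group `GL(X)` of all
invertible operators, with respect to the operator norm. -/
def StructurallyStableRelGL (T : X ≃L[𝕜] X) : Prop :=
  ∃ ε : ℝ, 0 < ε ∧ ∀ S : X ≃L[𝕜] X, ‖(S : X →L[𝕜] X) - (T : X →L[𝕜] X)‖ ≤ ε →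
    TopologicallyConjugate S T

/-- The spectrum of the complexification `T_ℂ` of `T`, which acts on `ℂ ⊗[ℝ] X`. It consists of
the `λ : ℂ` for which `T_ℂ - λ` is not bijective; on a Banach space this is the same as `T_ℂ - λ`
having no bounded inverse. The real structure of `X` is the one given by `ℝ → 𝕜`; the definition
is used for `𝕜 = ℝ`. -/
def complexifiedSpectrum (T : X →L[𝕜] X) : Set ℂ :=
  letI : Module ℝ X := Module.compHom X (algebraMap ℝ 𝕜)
  haveI : IsScalarTower ℝ 𝕜 X := .of_algebraMap_smul fun _ _ => rfl
  spectrum ℂ (((T : X →ₗ[𝕜] X).restrictScalars ℝ).baseChange ℂ : Module.End ℂ (ℂ ⊗[ℝ] X))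

/-- Hyperbolicity: the spectrum does not meet the unit circle; over the real scalars (the case
where the imaginary unit of `𝕜` is `0`), the spectrum of the complexification is meant. -/
def IsHyperbolic (T : X →L[𝕜] X) : Prop :=
  ((RCLike.I : 𝕜) ≠ 0 → Disjoint (spectrum 𝕜 T) (Metric.sphere 0 1)) ∧
  ((RCLike.I : 𝕜) = 0 → Disjoint (complexifiedSpectrum T) (Metric.sphere 0 1))

end Operators

/-! ### Weights -/

section Weights

variable {𝕜 : Type*} [RCLike 𝕜]

/-- The weight sequences of the invertible weighted shifts: `w` is bounded and `inf |w n| > 0`. -/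
structure IsInvertibleWeight (w : ℤ → 𝕜) : Prop where
  bddAbove : BddAbove (Set.range fun n => ‖w n‖)
  iInf_pos : 0 < ⨅ n, ‖w n‖

/-- Condition (C): `lim_n sup_{k ≥ 1} |w_{-k} w_{-k-1} ⋯ w_{-k-n}|^(1/n) < 1` and
`lim_n inf_{k ≥ 1} |w_k w_{k+1} ⋯ w_{k+n}|^(1/n) > 1`. -/
def ConditionC (w : ℤ → 𝕜) : Prop :=
  (∃ a : ℝ, a < 1 ∧ Tendsto (fun n : ℕ => ⨆ k : ℕ+,
    ‖∏ j ∈ Finset.range (n + 1), w (-(k : ℤ) - (j : ℤ))‖ ^ (1 / (n : ℝ))) atTop (𝓝 a)) ∧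
  (∃ b : ℝ, 1 < b ∧ Tendsto (fun n : ℕ => ⨅ k : ℕ+,
    ‖∏ j ∈ Finset.range (n + 1), w ((k : ℤ) + (j : ℤ))‖ ^ (1 / (n : ℝ))) atTop (𝓝 b))

theorem IsInvertibleWeight.exists_bound {w : ℤ → 𝕜} (hw : IsInvertibleWeight w) :
    ∃ C : ℝ, 0 ≤ C ∧ ∀ n, ‖w n‖ ≤ C := by
  obtain ⟨C, hC⟩ := hw.bddAbove
  exact ⟨C, (norm_nonneg _).trans (hC ⟨0, rfl⟩), fun n => hC ⟨n, rfl⟩⟩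

theorem IsInvertibleWeight.iInf_le {w : ℤ → 𝕜} (_hw : IsInvertibleWeight w) (n : ℤ) :
    ⨅ n, ‖w n‖ ≤ ‖w n‖ :=
  ciInf_le ⟨0, by rintro _ ⟨m, rfl⟩; exact norm_nonneg _⟩ n

theorem IsInvertibleWeight.ne_zero {w : ℤ → 𝕜} (hw : IsInvertibleWeight w) (n : ℤ) : w n ≠ 0 :=
  norm_pos_iff.1 (hw.iInf_pos.trans_le (hw.iInf_le n))

theorem IsInvertibleWeight.exists_bound_inv {w : ℤ → 𝕜} (hw : IsInvertibleWeight w) :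
    ∃ C : ℝ, 0 ≤ C ∧ ∀ n, ‖(w n)⁻¹‖ ≤ C :=
  ⟨(⨅ n, ‖w n‖)⁻¹, inv_nonneg.2 hw.iInf_pos.le, fun n => by
    rw [norm_inv]
    exact inv_anti₀ hw.iInf_pos (hw.iInf_le n)⟩

end Weights

/-! ### The spaces `ℓ_p(ℤ)`, `c_0(ℤ)` and the weighted backward shifts on them -/

section Shifts

variable {𝕜 : Type*} [RCLike 𝕜]

/-- The map `x ↦ (u n * x (σ n))` on `ℓ_p(ℤ)`, for bounded `u` and a permutation `σ` of `ℤ`. -/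
def lpMulComp (p : ℝ≥0∞) [Fact (1 ≤ p)] (hp : p ≠ ∞) (u : ℤ → 𝕜) (σ : ℤ ≃ ℤ)
    (hu : ∃ C : ℝ, 0 ≤ C ∧ ∀ n, ‖u n‖ ≤ C) :
    lp (fun _ : ℤ => 𝕜) p →L[𝕜] lp (fun _ : ℤ => 𝕜) p :=
  have hp0 : 0 < p.toReal := ENNReal.toReal_pos (zero_lt_one.trans_le Fact.out).ne' hp
  have key : ∀ C : ℝ, (∀ n, ‖u n‖ ≤ C) → ∀ (x : lp (fun _ : ℤ => 𝕜) p) (n : ℤ),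
      ‖u n * x (σ n)‖ ^ p.toReal ≤ C ^ p.toReal * ‖x (σ n)‖ ^ p.toReal := fun C hC x n => by
    rw [norm_mul, Real.mul_rpow (norm_nonneg _) (norm_nonneg _)]
    gcongr
    exact hC n
  have hs : ∀ (C : ℝ) (x : lp (fun _ : ℤ => 𝕜) p),
      Summable fun n => C ^ p.toReal * ‖x (σ n)‖ ^ p.toReal := fun C x =>
    ((σ.summable_iff (f := fun n => ‖x n‖ ^ p.toReal)).2
      ((lp.memℓp x).summable hp0)).mul_left _
  LinearMap.mkContinuousOfExistsBound
    { toFun := fun x => ⟨fun n => u n * x (σ n), by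
        obtain ⟨C, -, hC⟩ := hu
        exact (memℓp_gen_iff hp0).2 (Summable.of_nonneg_of_le
          (fun n => Real.rpow_nonneg (norm_nonneg _) _) (key C hC x) (hs C x))⟩
      map_add' := fun x y => by ext n; exact mul_add _ _ _
      map_smul' := fun c x => by ext n; exact mul_left_comm _ _ _ } (by
    obtain ⟨C, hC0, hC⟩ := hu
    refine ⟨C, fun x => lp.norm_le_of_forall_sum_le hp0
      (mul_nonneg hC0 (norm_nonneg _)) fun s => ?_⟩
    refine (Finset.sum_le_sum fun n _ => key C hC x n).trans ?_
    refine ((hs C x).sum_le_tsum s fun n _ => by positivity).trans ?_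
    rw [tsum_mul_left, σ.tsum_eq (fun n => ‖x n‖ ^ p.toReal), ← lp.norm_rpow_eq_tsum hp0,
      Real.mul_rpow hC0 (norm_nonneg _)])

/-- The map `x ↦ (u n * x (σ n))` on `c_0(ℤ)`, for bounded `u` and a permutation `σ` of `ℤ`. -/
def c0MulComp (u : ℤ → 𝕜) (σ : ℤ ≃ ℤ) (hu : ∃ C : ℝ, 0 ≤ C ∧ ∀ n, ‖u n‖ ≤ C) :
    C₀(ℤ, 𝕜) →L[𝕜] C₀(ℤ, 𝕜) :=
  LinearMap.mkContinuousOfExistsBound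
    { toFun := fun x =>
        { toFun := fun n => u n * x (σ n)
          continuous_toFun := continuous_of_discreteTopology
          zero_at_infty' := by
            obtain ⟨C, -, hC⟩ := hu
            have hx := zero_at_infty x
            rw [cocompact_eq_cofinite] at hx ⊢
            have h := ((hx.comp σ.injective.tendsto_cofinite).norm).const_mul C
            rw [norm_zero, mul_zero] at h
            refine squeeze_zero_norm (fun n => ?_) h
            rw [norm_mul]
            exact mul_le_mul_of_nonneg_right (hC n) (norm_nonneg _) }
      map_add' := fun x y => by ext n; exact mul_add _ _ _
      map_smul' := fun c x => by ext n; exact mul_left_comm _ _ _ } (by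
    obtain ⟨C, hC0, hC⟩ := hu
    refine ⟨C, fun x => ?_⟩
    rw [← ZeroAtInftyContinuousMap.norm_toBCF_eq_norm,
      BoundedContinuousFunction.norm_le (mul_nonneg hC0 (norm_nonneg _))]
    intro n
    refine (norm_mul_le _ _).trans (mul_le_mul (hC n) ?_ (norm_nonneg _) hC0)
    rw [← ZeroAtInftyContinuousMap.norm_toBCF_eq_norm (f := x)]
    exact x.toBCF.norm_coe_le_norm (σ n))

/-- The invertible bilateral weighted backward shift `B_w : (x n) ↦ (w (n+1) * x (n+1))` on
`ℓ_p(ℤ)`, `1 ≤ p < ∞`; its inverse is `(x n) ↦ ((w n)⁻¹ * x (n-1))`. -/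
def lpShift (p : ℝ≥0∞) [Fact (1 ≤ p)] (hp : p ≠ ∞) (w : ℤ → 𝕜) (hw : IsInvertibleWeight w) :
    lp (fun _ : ℤ => 𝕜) p ≃L[𝕜] lp (fun _ : ℤ => 𝕜) p :=
  ContinuousLinearEquiv.equivOfInverse
    (lpMulComp p hp (fun n => w (n + 1)) (Equiv.addRight 1)
      (hw.exists_bound.imp fun _ h => ⟨h.1, fun n => h.2 (n + 1)⟩))
    (lpMulComp p hp (fun n => (w n)⁻¹) (Equiv.subRight 1) hw.exists_bound_inv)
    (fun x => by
      ext n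
      change (w n)⁻¹ * (w (n - 1 + 1) * x (n - 1 + 1)) = x n
      rw [sub_add_cancel, inv_mul_cancel_left₀ (hw.ne_zero n)])
    (fun x => by
      ext n
      change w (n + 1) * ((w (n + 1))⁻¹ * x (n + 1 - 1)) = x n
      rw [add_sub_cancel_right, mul_inv_cancel_left₀ (hw.ne_zero _)])

theorem lpShift_apply (p : ℝ≥0∞) [Fact (1 ≤ p)] (hp : p ≠ ∞) (w : ℤ → 𝕜)
    (hw : IsInvertibleWeight w) (x : lp (fun _ : ℤ => 𝕜) p) (n : ℤ) :
    lpShift p hp w hw x n = w (n + 1) * x (n + 1) := rfl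

/-- The invertible bilateral weighted backward shift `B_w : (x n) ↦ (w (n+1) * x (n+1))` on
`c_0(ℤ)`; its inverse is `(x n) ↦ ((w n)⁻¹ * x (n-1))`. -/
def c0Shift (w : ℤ → 𝕜) (hw : IsInvertibleWeight w) : C₀(ℤ, 𝕜) ≃L[𝕜] C₀(ℤ, 𝕜) :=
  ContinuousLinearEquiv.equivOfInverse
    (c0MulComp (fun n => w (n + 1)) (Equiv.addRight 1)
      (hw.exists_bound.imp fun _ h => ⟨h.1, fun n => h.2 (n + 1)⟩))
    (c0MulComp (fun n => (w n)⁻¹) (Equiv.subRight 1) hw.exists_bound_inv)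
    (fun x => by
      ext n
      change (w n)⁻¹ * (w (n - 1 + 1) * x (n - 1 + 1)) = x n
      rw [sub_add_cancel, inv_mul_cancel_left₀ (hw.ne_zero n)])
    (fun x => by
      ext n
      change w (n + 1) * ((w (n + 1))⁻¹ * x (n + 1 - 1)) = x n
      rw [add_sub_cancel_right, mul_inv_cancel_left₀ (hw.ne_zero _)])

theorem c0Shift_apply (w : ℤ → 𝕜) (hw : IsInvertibleWeight w) (x : C₀(ℤ, 𝕜)) (n : ℤ) :
    c0Shift w hw x n = w (n + 1) * x (n + 1) := rfl

end Shifts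

end

/-!
Shadowing for an invertible operator `T` amounts to solvability of `y (n + 1) = T (y n) + z n` in
bounded sequences. If this equation is solved by a convolution `y n = ∑ k, G k (z (n - k))` with
summable operator norms (`IsGreenFunction`), then `T` is structurally stable even though the solution need
not be unique: for a perturbation `S = T + φ` the map `h = id - ∑ k, G k ∘ φ ∘ S⁻ᵏ` satisfies
`h ∘ S = T ∘ h`, the contraction principle produces a continuous right inverse of `h` by the same
formula along orbits of `T`, and a supremum estimate along orbits makes `h` injective
(`IsGreenFunction.structurallyStable`).

For a weighted shift everything is governed by the products `p n` of the weights. Testing the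
shadowing property on pseudotrajectories whose errors are multiples of single unit vectors reduces
it to a scalar recursion with bounded solutions, which forces an exponential dichotomy of `‖p‖`: on
a set `E` of indices the products contract backwards, off `E` they contract forwards
(`IsWeightedShift.exists_hasDichotomy`). A dichotomy gives a Green function made of powers of the
shift composed with the coordinate projections onto `E` and its complement
(`IsWeightedShift.exists_isGreenFunction`). Condition (C) gives a dichotomy with `E` the negative
integers.

In that last case `t ^ n / p n` is an eigenvector with eigenvalue `t` for all `t ≥ 1` near `1`. The
eigenvalue `1` excludes hyperbolicity. As some `t > 1` is an eigenvalue, the largest element of the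
real spectrum exceeds `1`, and since the resolvent blows up there, some operator `S` arbitrarily
near `T` has a functional `g ≠ 0` with `g ∘ S = t • g`, `t > 1`. Points whose forward orbit
converges lie in the kernel of `g` for `S`, whereas for `T` they are dense, because they include all
finitely supported sequences. Density of this set of points is a conjugacy invariant, so `T` is not
structurally stable relative to `GL(X)` (`not_structurallyStableRelGL`).

The arguments are carried out for an abstract `SequenceSpace`, of which `ℓ_p(ℤ)` and `c_0(ℤ)` are
instances.
-/

noncomputable section

/-! ### Green functions and structural stability -/

section Green

variable {𝕜 X : Type*} [RCLike 𝕜] [NormedAddCommGroup X] [NormedSpace 𝕜 X]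

/-- A Green function of `T`: an absolutely summable family of operators `G k`, `k : ℤ`, with
`G (k + 1) = T ∘ G k` for `k ≠ 0` and a jump by the identity at `k = 0`. Then
`y n = ∑ k, G k (z (n - k))` is a bounded solution of `y (n + 1) = T (y n) + z n` for every
bounded `z : ℤ → X`. -/
structure IsGreenFunction (T : X ≃L[𝕜] X) (G : ℤ → X →L[𝕜] X) : Prop where
  summable : Summable fun k => ‖G k‖
  succ : ∀ k x, G (k + 1) x = T (G k x) + if k = 0 then x else 0

/-- The sum `∑ k, G k (ψ (R⁻ᵏ x))`, which for a Green function `G` of `T` solves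
`u (R x) = T (u x) + ψ x`. -/
def greenSum (G : ℤ → X →L[𝕜] X) (R : X ≃ₜ X) (ψ : X →ᵇ X) (x : X) : X :=
  ∑' k, G k (ψ ((R ^ (-k)) x))

variable {T : X ≃L[𝕜] X} {G : ℤ → X →L[𝕜] X}

theorem homeomorph_zpow_add_apply (R : X ≃ₜ X) (m n : ℤ) (x : X) :
    (R ^ (m + n)) x = (R ^ m) ((R ^ n) x) := by
  rw [zpow_add, Homeomorph.mul_apply]

theorem homeomorph_zpow_semiconj {R S : X ≃ₜ X} {g : X → X} (h : ∀ x, g (R x) = S (g x))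
    (n : ℤ) (x : X) : g ((R ^ n) x) = (S ^ n) (g x) := by
  induction n generalizing x with
  | zero => rfl
  | succ n ih =>
    rw [homeomorph_zpow_add_apply, homeomorph_zpow_add_apply, ih, zpow_one, zpow_one, h]
  | pred n ih =>
    have h' : g (R⁻¹ x) = S⁻¹ (g x) := by
      have := h (R⁻¹ x)
      rw [← Homeomorph.mul_apply, mul_inv_cancel] at this
      rw [show g x = S (g (R⁻¹ x)) from this, ← Homeomorph.mul_apply, inv_mul_cancel]
      rfl
    rw [sub_eq_add_neg, homeomorph_zpow_add_apply, homeomorph_zpow_add_apply, ih, zpow_neg_one,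
      zpow_neg_one, h']

namespace IsGreenFunction

theorem norm_tsum_apply_le (hG : IsGreenFunction T G) {z : ℤ → X} {D : ℝ}
    (hz : ∀ k, ‖z k‖ ≤ D) :
    ‖∑' k, G k (z k)‖ ≤ (∑' k, ‖G k‖) * D := by
  rw [← tsum_mul_right]
  exact tsum_of_norm_bounded (hG.summable.mul_right D).hasSum fun k =>
    (G k).le_of_opNorm_le_of_le le_rfl (hz k)

theorem norm_greenSum_le (hG : IsGreenFunction T G) (R : X ≃ₜ X) (ψ : X →ᵇ X) (x : X) :
    ‖greenSum G R ψ x‖ ≤ (∑' k, ‖G k‖) * ‖ψ‖ :=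
  hG.norm_tsum_apply_le fun _ => ψ.norm_coe_le_norm _

variable [CompleteSpace X]

theorem summable_apply (hG : IsGreenFunction T G) {z : ℤ → X} {D : ℝ}
    (hz : ∀ k, ‖z k‖ ≤ D) :
    Summable fun k => G k (z k) :=
  .of_norm_bounded (hG.summable.mul_right D) fun k =>
    (G k).le_of_opNorm_le_of_le le_rfl (hz k)

theorem continuous_greenSum (hG : IsGreenFunction T G) (R : X ≃ₜ X) (ψ : X →ᵇ X) :
    Continuous (greenSum G R ψ) :=
  continuous_tsum (fun k => (G k).continuous.comp (ψ.continuous.comp (R ^ (-k)).continuous))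
    (hG.summable.mul_right ‖ψ‖) fun k _ => (G k).le_of_opNorm_le_of_le le_rfl (ψ.norm_coe_le_norm _)

/-- The shift `k ↦ k + 1` of the summation index turns the defining relation of a Green function
into the cohomological equation. -/
theorem greenSum_apply_self (hG : IsGreenFunction T G) (R : X ≃ₜ X) (ψ : X →ᵇ X) (x : X) :
    greenSum G R ψ (R x) = T (greenSum G R ψ x) + ψ x := by
  have hs := hG.summable_apply (z := fun k => ψ ((R ^ (-k)) x)) fun _ => ψ.norm_coe_le_norm _
  have h1 : HasSum (fun k => T (G k (ψ ((R ^ (-k)) x)))) (T (greenSum G R ψ x)) :=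
    hs.hasSum.mapL (T : X →L[𝕜] X)
  have h2 : HasSum (fun k : ℤ => if k = 0 then ψ ((R ^ (-k)) x) else 0) (ψ x) := by
    convert hasSum_ite_eq (0 : ℤ) (ψ x) using 2 with k
    split_ifs with hk
    · subst hk; rfl
    · rfl
  have h3 := h1.add h2
  refine Eq.trans ?_ h3.tsum_eq
  rw [greenSum, ← (Equiv.addRight (1 : ℤ)).tsum_eq]
  refine tsum_congr fun k => ?_
  have : (R ^ (-(k + 1))) (R x) = (R ^ (-k)) x := by
    rw [neg_add, homeomorph_zpow_add_apply, zpow_neg_one, ← Homeomorph.mul_apply R⁻¹,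
      inv_mul_cancel]
    rfl
  simp only [Equiv.coe_addRight, this, hG.succ]

/-- An operator with a Green function `G` is structurally stable. For a small perturbation
`S = T + φ`, the conjugacy from `S` to `T` is `h = id - ∑ k, G k ∘ φ ∘ S⁻ᵏ`. A continuous right
inverse `g = id + v` of `h` is obtained from the fixed point `v` of
`v ↦ ∑ k, G k ∘ φ ∘ (id + v) ∘ T⁻ᵏ`, and `h` is injective because two `S`-orbits with the same
image under `h` stay at bounded distance, while the Green function bounds the supremum of this
distance by half of it. -/
theorem structurallyStable (hG : IsGreenFunction T G) : StructurallyStable T := by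
  set K : ℝ := ∑' k, ‖G k‖ with hK
  have hK0 : 0 ≤ K := tsum_nonneg fun k => norm_nonneg _
  obtain ⟨c, hc0, hc⟩ : ∃ c : ℝ≥0, 0 < c ∧
      (Subsingleton X ∨ c < ‖(T.symm : X →L[𝕜] X)‖₊⁻¹) := by
    rcases subsingleton_or_nontrivial X with hX | hX
    · exact ⟨1, one_pos, .inl hX⟩
    · have h0 : 0 < ‖(T.symm : X →L[𝕜] X)‖₊⁻¹ := inv_pos.2 T.nnnorm_symm_pos
      exact ⟨_, half_pos h0, .inr (NNReal.half_lt_self h0.ne')⟩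
  set ε : ℝ≥0 := min c (1 / (2 * (⟨K, hK0⟩ + 1))) with hε
  have hεpos : 0 < ε := by
    refine lt_min hc0 ?_
    positivity
  have hεK : K * ε ≤ 1 / 2 := by
    have h1 : (ε : ℝ) ≤ 1 / (2 * (K + 1)) := by
      have : ε ≤ 1 / (2 * (⟨K, hK0⟩ + 1)) := min_le_right _ _
      exact_mod_cast this
    calc K * ε ≤ K * (1 / (2 * (K + 1))) := by gcongr
      _ ≤ 1 / 2 := by
        rw [mul_one_div, div_le_div_iff₀ (by positivity) (by positivity)]
        linarith
  refine ⟨ε, hεpos, fun φ _ hφL => ?_⟩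
  have happ : ApproximatesLinearOn (fun x => T x + φ x) (T : X →L[𝕜] X) Set.univ ε := by
    intro x _ y _
    have := hφL.dist_le_mul x y
    rw [dist_eq_norm, dist_eq_norm] at this
    change ‖T x + φ x - (T y + φ y) - T (x - y)‖ ≤ _
    rwa [map_sub, show T x + φ x - (T y + φ y) - (T x - T y) = φ x - φ y by abel]
  have hcε : Subsingleton X ∨ ε < ‖(T.symm : X →L[𝕜] X)‖₊⁻¹ :=
    hc.imp id fun h => (min_le_left _ _).trans_lt h
  obtain ⟨S, hS⟩ : ∃ S : X ≃ₜ X, ∀ x, S x = T x + φ x :=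
    ⟨happ.toHomeomorph _ hcε, fun x => rfl⟩
  set T' : X ≃ₜ X := T.toHomeomorph with hT'
  set h : X → X := fun x => x - greenSum G S φ x with hh
  have hcont : Continuous h := continuous_id.sub (hG.continuous_greenSum S φ)
  have hconj : ∀ x, h (S x) = T (h x) := fun x => by
    simp only [hh]
    rw [hG.greenSum_apply_self, hS, map_sub]
    abel
  have hconjn := homeomorph_zpow_semiconj (R := S) (S := T') (g := h) hconj
  -- The perturbation with `id + v` inserted, as a bounded continuous map.
  let comp : (X →ᵇ X) → (X →ᵇ X) := fun v => BoundedContinuousFunction.ofNormedAddCommGroup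
    (fun x => φ (x + v x)) (φ.continuous.comp (continuous_id.add v.continuous)) ‖φ‖
    fun x => φ.norm_coe_le_norm _
  let F : (X →ᵇ X) → (X →ᵇ X) := fun v => BoundedContinuousFunction.ofNormedAddCommGroup
    (greenSum G T' (comp v)) (hG.continuous_greenSum T' _) (K * ‖comp v‖)
    (hG.norm_greenSum_le T' _)
  have hF : ContractingWith (1 / 2) F := by
    refine ⟨NNReal.half_lt_self one_ne_zero, LipschitzWith.of_dist_le_mul fun v₁ v₂ => ?_⟩
    refine (BoundedContinuousFunction.dist_le (by positivity)).2 fun x => ?_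
    have hb : ∀ (v : X →ᵇ X) (k : ℤ), ‖comp v ((T' ^ (-k)) x)‖ ≤ ‖comp v‖ := fun v k =>
      (comp v).norm_coe_le_norm _
    change dist (greenSum G T' (comp v₁) x) (greenSum G T' (comp v₂) x) ≤ _
    rw [dist_eq_norm, greenSum, greenSum, ← (hG.summable_apply (hb v₁)).tsum_sub
      (hG.summable_apply (hb v₂))]
    simp only [← map_sub]
    refine (hG.norm_tsum_apply_le (D := ε * dist v₁ v₂) fun k => ?_).trans ?_
    · rw [← dist_eq_norm]
      refine (hφL.dist_le_mul _ _).trans ?_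
      rw [dist_add_left]
      gcongr
      exact BoundedContinuousFunction.dist_coe_le_dist _
    · rw [← mul_assoc]
      gcongr
      simpa using hεK
  obtain ⟨v, hv⟩ : ∃ v, F v = v := ⟨_, hF.fixedPoint_isFixedPt⟩
  have hv' : ∀ x, greenSum G T' (comp v) x = v x := fun x => DFunLike.congr_fun hv x
  set g : X → X := fun x => x + v x with hg
  have hgcont : Continuous g := continuous_id.add v.continuous
  have hgconj : ∀ x, g (T' x) = S (g x) := fun x => by
    have : v (T' x) = T (v x) + φ (x + v x) := by
      rw [← hv' (T' x), hG.greenSum_apply_self, hv']; rfl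
    simp only [hg, this, hS, map_add]
    change T x + _ = _
    abel
  have hgconjn := homeomorph_zpow_semiconj (R := T') (S := S) (g := g) hgconj
  have hhg : ∀ x, h (g x) = x := fun x => by
    have : greenSum G S φ (g x) = v x := by
      rw [← hv', greenSum, greenSum]
      exact tsum_congr fun k => by rw [← hgconjn]; rfl
    simp only [hh]
    rw [this]
    exact add_sub_cancel_right x (v x)
  have hinj : Function.Injective h := fun x x' hxx => by
    have hd : ∀ n : ℤ, (S ^ n) x - (S ^ n) x' =
        ∑' k, G k (φ ((S ^ (n - k)) x) - φ ((S ^ (n - k)) x')) := fun n => by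
      have e : h ((S ^ n) x) = h ((S ^ n) x') := by rw [hconjn, hconjn, hxx]
      have e' : (S ^ n) x - (S ^ n) x' = greenSum G S φ ((S ^ n) x) -
          greenSum G S φ ((S ^ n) x') := by
        simp only [hh] at e
        rw [sub_eq_sub_iff_sub_eq_sub] at e
        exact e
      rw [e', greenSum, greenSum, ← (hG.summable_apply fun _ => φ.norm_coe_le_norm _).tsum_sub
        (hG.summable_apply fun _ => φ.norm_coe_le_norm _)]
      refine tsum_congr fun k => ?_
      rw [← map_sub, ← homeomorph_zpow_add_apply, ← homeomorph_zpow_add_apply,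
        show -k + n = n - k by ring]
    have hbdd : BddAbove (Set.range fun n : ℤ => ‖(S ^ n) x - (S ^ n) x'‖) := by
      refine ⟨K * (‖φ‖ + ‖φ‖), ?_⟩
      rintro _ ⟨n, rfl⟩
      simp only
      rw [hd]
      exact hG.norm_tsum_apply_le fun k =>
        (norm_sub_le _ _).trans (add_le_add (φ.norm_coe_le_norm _) (φ.norm_coe_le_norm _))
    set D := ⨆ n : ℤ, ‖(S ^ n) x - (S ^ n) x'‖ with hD
    have hle : ∀ n : ℤ, ‖(S ^ n) x - (S ^ n) x'‖ ≤ D := fun n => le_ciSup hbdd n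
    have hD0 : 0 ≤ D := (norm_nonneg _).trans (hle 0)
    have hD2 : D ≤ 1 / 2 * D := ciSup_le fun n => by
      rw [hd]
      refine (hG.norm_tsum_apply_le (D := ε * D) fun k => ?_).trans ?_
      · rw [← dist_eq_norm]
        refine (hφL.dist_le_mul _ _).trans ?_
        rw [dist_eq_norm]
        gcongr
        exact hle _
      · rw [← mul_assoc]
        gcongr
    have h0 := hle 0
    have : ‖x - x'‖ ≤ 0 := by
      change ‖x - x'‖ ≤ D at h0
      linarith
    exact sub_eq_zero.1 (norm_le_zero_iff.1 this)
  refine ⟨⟨⟨h, g, fun x => hinj (hhg (h x)), hhg⟩, hcont, hgcont⟩, fun x => ?_⟩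
  change h (T x + φ x) = T (h x)
  rw [← hS, hconj]

end IsGreenFunction

end Green

/-! ### Weight products and the dichotomy -/

/-- A nonautonomous recursion by bijections has a two-sided solution with given initial value. -/
theorem exists_int_orbit {α : Type*} (f : ℤ → α ≃ α) (a : α) :
    ∃ x : ℤ → α, x 0 = a ∧ ∀ n, x (n + 1) = f n (x n) := by
  let x : ℤ → α := fun n => match n with
    | .ofNat n => Nat.rec a (fun k y => f k y) n
    | .negSucc n => Nat.rec ((f (-1)).symm a) (fun k y => (f (Int.negSucc (k + 1))).symm y) n
  refine ⟨x, rfl, fun n => ?_⟩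
  match n with
  | .ofNat n => rfl
  | .negSucc 0 => exact ((f (-1)).apply_symm_apply a).symm
  | .negSucc (n + 1) =>
    change x (Int.negSucc n) = f _ ((f _).symm (x (Int.negSucc n)))
    rw [Equiv.apply_symm_apply]

section Dichotomy

variable {𝕜 : Type*} [RCLike 𝕜]

/-- A nowhere vanishing solution of `p (n + 1) = w (n + 1) * p n`. Up to a constant factor, `p n`
is `w 1 * ⋯ * w n` for `n ≥ 0` and `(w (n + 1) * ⋯ * w 0)⁻¹` for `n < 0`. -/
structure IsWeightProduct (w p : ℤ → 𝕜) : Prop where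
  ne_zero : ∀ n, p n ≠ 0
  succ : ∀ n, p (n + 1) = w (n + 1) * p n

theorem exists_isWeightProduct {w : ℤ → 𝕜} (hw : ∀ n, w n ≠ 0) :
    ∃ p, IsWeightProduct w p := by
  obtain ⟨p, hp0, hp⟩ := exists_int_orbit (fun n => Equiv.mulLeft₀ (w (n + 1)) (hw _)) (1 : 𝕜)
  have hp' : ∀ n, p (n + 1) = w (n + 1) * p n := hp
  refine ⟨p, fun n => ?_, hp'⟩
  induction n with
  | zero => rw [hp0]; exact one_ne_zero
  | succ n ih => rw [hp']; exact mul_ne_zero (hw _) ih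
  | pred n ih =>
    intro h
    have := hp' (-n - 1)
    rw [sub_add_cancel, h, mul_zero] at this
    exact ih this

/-- The dichotomy on a set `E` of indices: the weight products contract exponentially when
followed backwards from a point of `E`, and the inverse products contract exponentially when
followed forwards from a point outside `E`. -/
def HasDichotomy (p : ℤ → 𝕜) (E : Set ℤ) : Prop :=
  ∃ C r : ℝ, 0 ≤ C ∧ 0 < r ∧ r < 1 ∧
    (∀ j ∈ E, ∀ k : ℕ, ‖p j‖ ≤ C * r ^ k * ‖p (j - k)‖) ∧
    (∀ j ∉ E, ∀ k : ℕ, ‖p j‖ ≤ C * r ^ k * ‖p (j + k)‖)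

theorem IsWeightProduct.prod_sub {w p : ℤ → 𝕜} (hp : IsWeightProduct w p) (i : ℤ) (n : ℕ) :
    (∏ j ∈ Finset.range n, w (i - j)) * p (i - n) = p i := by
  induction n with
  | zero => simp
  | succ n ih =>
    rw [← ih, Finset.prod_range_succ, mul_assoc]
    congr 1
    have := hp.succ (i - n - 1)
    rw [sub_add_cancel] at this
    rw [this]
    push_cast
    rw [sub_sub]

theorem IsWeightProduct.prod_add {w p : ℤ → 𝕜} (hp : IsWeightProduct w p) (i : ℤ) (n : ℕ) :
    (∏ j ∈ Finset.range n, w (i + 1 + j)) * p i = p (i + n) := by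
  induction n with
  | zero => simp
  | succ n ih =>
    rw [Finset.prod_range_succ, mul_right_comm, ih]
    have := hp.succ (i + n)
    push_cast
    rw [← add_assoc, this, mul_comm, add_right_comm]

/-- An exponential bound valid for all large lengths, together with a crude bound for every
length, gives an exponential bound for all lengths, at the price of a constant. -/
theorem exists_exponential_bound {ι : Type*} {f : ι → ℕ → ℝ} {M r : ℝ} (hM : 1 ≤ M) (hr : 0 < r)
    (hr1 : r < 1) (hf : ∀ i n, f i n ≤ M ^ n)
    (h : ∀ᶠ n : ℕ in atTop, ∀ i, f i (n + 1) ≤ r ^ n) :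
    ∃ C : ℝ, 0 ≤ C ∧ ∀ i n, f i n ≤ C * r ^ n := by
  obtain ⟨N, hN⟩ := eventually_atTop.1 h
  have hMr : 1 ≤ M / r := (one_le_div hr).2 (hr1.le.trans hM)
  refine ⟨(M / r) ^ (N + 1), by positivity, fun i n => ?_⟩
  rcases le_or_gt n N with hn | hn
  · calc f i n ≤ M ^ n := hf i n
      _ = (M / r) ^ n * r ^ n := by rw [← mul_pow, div_mul_cancel₀ _ hr.ne']
      _ ≤ (M / r) ^ (N + 1) * r ^ n := by
        gcongr
        · exact hn.trans (Nat.le_succ N)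
  · obtain ⟨m, rfl⟩ : ∃ m, n = m + 1 := ⟨n - 1, by omega⟩
    calc f i (m + 1) ≤ r ^ m := hN m (by omega) i
      _ = r⁻¹ * r ^ (m + 1) := by rw [pow_succ]; field_simp
      _ ≤ (M / r) ^ (N + 1) * r ^ (m + 1) := by
        gcongr
        calc r⁻¹ ≤ M / r := by
              rw [← one_div]; gcongr
          _ ≤ (M / r) ^ (N + 1) := le_self_pow₀ hMr (by omega)

theorem norm_prod_le_pow {v : ℤ → 𝕜} {M : ℝ} (hv : ∀ n, ‖v n‖ ≤ M) (g : ℕ → ℤ) (n : ℕ) :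
    ‖∏ j ∈ Finset.range n, v (g j)‖ ≤ M ^ n := by
  rw [norm_prod]
  refine (Finset.prod_le_prod (fun _ _ => norm_nonneg _) fun j _ => hv (g j)).trans ?_
  simp

theorem ConditionC.hasDichotomy {w p : ℤ → 𝕜} (hw : IsInvertibleWeight w)
    (hp : IsWeightProduct w p) (hC : ConditionC w) : HasDichotomy p {j | j < 0} := by
  obtain ⟨⟨a, ha, hlim⟩, b, hb, hlim'⟩ := hC
  obtain ⟨M₁, -, hM₁⟩ := hw.exists_bound
  obtain ⟨M₂, -, hM₂⟩ := hw.exists_bound_inv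
  obtain ⟨r, hr0, hr1, har, hbr⟩ : ∃ r : ℝ, 0 < r ∧ r < 1 ∧ a < r ∧ r⁻¹ < b := by
    obtain ⟨r, hr, hr1⟩ := exists_between (max_lt (max_lt ha one_pos)
      (inv_lt_one_of_one_lt₀ hb) : max (max a 0) b⁻¹ < 1)
    have h1 : b⁻¹ < r := (le_max_right _ _).trans_lt hr
    have h2 : 0 < r := ((le_max_right _ _).trans (le_max_left _ _)).trans_lt hr
    exact ⟨r, h2, hr1, ((le_max_left _ _).trans (le_max_left _ _)).trans_lt hr,
      inv_lt_of_inv_lt₀ (by linarith) h1⟩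
  set M := max 1 (max M₁ M₂) with hMdef
  have hM : 1 ≤ M := le_max_left _ _
  have hwM : ∀ n, ‖w n‖ ≤ M := fun n => (hM₁ n).trans ((le_max_left _ _).trans (le_max_right _ _))
  have hwM' : ∀ n, ‖(w n)⁻¹‖ ≤ M := fun n =>
    (hM₂ n).trans ((le_max_right _ _).trans (le_max_right _ _))
  obtain ⟨C₁, hC₁, h₁⟩ := exists_exponential_bound (ι := ℕ+)
    (f := fun k n => ‖∏ j ∈ Finset.range n, w (-(k : ℤ) - (j : ℤ))‖) hM hr0 hr1
    (fun k n => norm_prod_le_pow hwM _ n) (by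
      filter_upwards [hlim.eventually_lt_const har, eventually_ge_atTop 1] with n hn hn1 k
      have hbdd : BddAbove (Set.range fun k : ℕ+ =>
          ‖∏ j ∈ Finset.range (n + 1), w (-(k : ℤ) - (j : ℤ))‖ ^ (1 / (n : ℝ))) := by
        refine ⟨(M ^ (n + 1)) ^ (1 / (n : ℝ)), ?_⟩
        rintro _ ⟨k, rfl⟩
        exact Real.rpow_le_rpow (norm_nonneg _) (norm_prod_le_pow hwM _ _) (by positivity)
      have h := (le_ciSup hbdd k).trans hn.le
      rwa [one_div, Real.rpow_inv_le_iff_of_pos (norm_nonneg _) hr0.le (by positivity),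
        Real.rpow_natCast] at h)
  obtain ⟨C₂, hC₂, h₂⟩ := exists_exponential_bound (ι := ℕ+)
    (f := fun k n => ‖∏ j ∈ Finset.range n, (w ((k : ℤ) + (j : ℤ)))⁻¹‖) hM hr0 hr1
    (fun k n => norm_prod_le_pow hwM' (fun j : ℕ => (k : ℤ) + j) n) (by
      filter_upwards [hlim'.eventually_const_lt hbr, eventually_ge_atTop 1] with n hn hn1 k
      have hbdd : BddBelow (Set.range fun k : ℕ+ =>
          ‖∏ j ∈ Finset.range (n + 1), w ((k : ℤ) + (j : ℤ))‖ ^ (1 / (n : ℝ))) := by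
        refine ⟨0, ?_⟩
        rintro _ ⟨k, rfl⟩
        positivity
      have h := hn.le.trans (ciInf_le hbdd k)
      rw [one_div, Real.le_rpow_inv_iff_of_pos (by positivity) (norm_nonneg _) (by positivity),
        Real.rpow_natCast] at h
      rw [Finset.prod_inv_distrib, norm_inv]
      refine inv_le_of_inv_le₀ (by positivity) ?_
      rwa [← inv_pow])
  refine ⟨max C₁ C₂, r, hC₁.trans (le_max_left _ _), hr0, hr1, fun j hj k => ?_, fun j hj k => ?_⟩
  · have hj' : j < 0 := hj
    obtain ⟨m, hm⟩ : ∃ m : ℕ+, (m : ℤ) = -j :=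
      ⟨⟨(-j).toNat, by omega⟩, Int.toNat_of_nonneg (by omega)⟩
    have h := h₁ m k
    rw [hm, neg_neg] at h
    rw [← hp.prod_sub j k, norm_mul]
    gcongr
    exact h.trans (by gcongr; exact le_max_left _ _)
  · have hj' : 0 ≤ j := not_lt.1 hj
    obtain ⟨m, hm⟩ : ∃ m : ℕ+, (m : ℤ) = j + 1 :=
      ⟨⟨(j + 1).toNat, by omega⟩, Int.toNat_of_nonneg (by omega)⟩
    have h := h₂ m k
    rw [hm] at h
    rw [Finset.prod_inv_distrib, norm_inv] at h
    have hpr := hp.prod_add j k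
    have hne : ∏ j_1 ∈ Finset.range k, w (j + 1 + j_1) ≠ 0 :=
      Finset.prod_ne_zero_iff.2 fun _ _ => hw.ne_zero _
    have e : ‖p j‖ = ‖∏ j_1 ∈ Finset.range k, w (j + 1 + j_1)‖⁻¹ * ‖p (j + k)‖ := by
      rw [← hpr, norm_mul, inv_mul_cancel_left₀ (norm_ne_zero_iff.2 hne)]
    rw [e]
    gcongr
    exact h.trans (by gcongr; exact le_max_right _ _)

/-- Under a dichotomy on the negative integers, the sequences `t ^ n / p n` decay at both ends for
`t ≥ 1` close to `1`. -/
theorem HasDichotomy.exists_summable_zpow_div {w p : ℤ → 𝕜} (hp : IsWeightProduct w p)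
    (hE : HasDichotomy p {j | j < 0}) :
    ∃ l : ℝ, 1 < l ∧ ∀ t : ℝ, 1 ≤ t → t < l → Summable fun n : ℤ => ‖(t : 𝕜) ^ n / p n‖ := by
  obtain ⟨C, r, hC, hr0, hr1, hin, hout⟩ := hE
  refine ⟨r⁻¹, (one_lt_inv₀ hr0).2 hr1, fun t ht htr => ?_⟩
  have ht0 : 0 < t := one_pos.trans_le ht
  have hpp : ∀ n, 0 < ‖p n‖ := fun n => norm_pos_iff.2 (hp.ne_zero n)
  have hnorm : ∀ n : ℤ, ‖(t : 𝕜) ^ n / p n‖ = t ^ n / ‖p n‖ := fun n => by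
    rw [norm_div, norm_zpow, RCLike.norm_ofReal, abs_of_pos ht0]
  have htr1 : t * r < 1 := by
    have := mul_lt_mul_of_pos_right htr hr0
    rwa [inv_mul_cancel₀ hr0.ne'] at this
  refine .of_nat_of_neg_add_one ?_ ?_
  · refine .of_nonneg_of_le (fun _ => norm_nonneg _) (fun n => ?_)
      ((summable_geometric_of_lt_one (by positivity) htr1).mul_left (C / ‖p 0‖))
    have h := hout 0 (by simp) n
    rw [zero_add] at h
    rw [hnorm, zpow_natCast, div_mul_eq_mul_div, div_le_div_iff₀ (hpp _) (hpp _), mul_pow]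
    calc t ^ n * ‖p 0‖ ≤ t ^ n * (C * r ^ n * ‖p n‖) := by gcongr
      _ = _ := by ring
  · refine .of_nonneg_of_le (fun _ => norm_nonneg _) (fun n => ?_)
      ((summable_geometric_of_lt_one hr0.le hr1).mul_left (C / ‖p (-1)‖))
    have h := hin (-1) (by simp) n
    rw [show (-1 : ℤ) - n = -(n + 1) by ring] at h
    rw [hnorm, div_mul_eq_mul_div, div_le_div_iff₀ (hpp _) (hpp _)]
    have h1 : t ^ (-((n : ℤ) + 1)) ≤ 1 := zpow_le_one_of_nonpos₀ ht (by omega)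
    calc t ^ (-((n : ℤ) + 1)) * ‖p (-1)‖ ≤ 1 * (C * r ^ n * ‖p (-(n + 1))‖) := by gcongr
      _ = _ := by ring

theorem summable_pow_natAbs {r : ℝ} (h0 : 0 ≤ r) (h1 : r < 1) :
    Summable fun k : ℤ => r ^ k.natAbs := by
  have h := summable_geometric_of_lt_one h0 h1
  refine .of_nat_of_neg_add_one (by simpa using h) ?_
  exact ((summable_nat_add_iff 1).2 h).congr fun n => by congr 1

theorem isInvertibleWeight_ite {a : ℝ} (ha : 1 < a) :
    IsInvertibleWeight (fun n : ℤ => if n < 0 then ((1 / a : ℝ) : 𝕜) else (a : 𝕜)) := by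
  have ha0 : 0 < a := one_pos.trans ha
  have h1 : 1 / a ≤ a := ((div_lt_one ha0).2 ha).le.trans ha.le
  have hn : ∀ n : ℤ, ‖(if n < 0 then ((1 / a : ℝ) : 𝕜) else (a : 𝕜))‖ =
      if n < 0 then 1 / a else a := fun n => by
    split_ifs
    · rw [RCLike.norm_ofReal, abs_of_pos (by positivity)]
    · rw [RCLike.norm_ofReal, abs_of_pos ha0]
  refine ⟨⟨a, ?_⟩, ?_⟩
  · rintro _ ⟨n, rfl⟩
    simp only [hn]
    split_ifs
    exacts [h1, le_rfl]
  · refine (by positivity : 0 < 1 / a).trans_le (le_ciInf fun n => ?_)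
    rw [hn]
    split_ifs
    exacts [le_rfl, h1]

theorem tendsto_pow_succ_rpow {c : ℝ} (hc : 0 < c) :
    Tendsto (fun n : ℕ => (c ^ (n + 1)) ^ (1 / (n : ℝ))) atTop (𝓝 c) := by
  have h1 : Tendsto (fun n : ℕ => c ^ (1 + 1 / (n : ℝ))) atTop (𝓝 (c ^ (1 + 0 : ℝ))) :=
    (Real.continuousAt_const_rpow hc.ne').tendsto.comp
      (tendsto_const_nhds.add tendsto_one_div_atTop_nhds_zero_nat)
  rw [add_zero, Real.rpow_one] at h1
  refine h1.congr' ?_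
  filter_upwards [eventually_ge_atTop 1] with n hn
  rw [← Real.rpow_natCast, ← Real.rpow_mul hc.le]
  congr 1
  have : (n : ℝ) ≠ 0 := by positivity
  push_cast
  field_simp

theorem conditionC_ite {a : ℝ} (ha : 1 < a) :
    ConditionC (fun n : ℤ => if n < 0 then ((1 / a : ℝ) : 𝕜) else (a : 𝕜)) := by
  have ha0 : 0 < a := one_pos.trans ha
  refine ⟨⟨1 / a, (div_lt_one ha0).2 ha, ?_⟩, a, ha, ?_⟩
  · refine (tendsto_pow_succ_rpow (by positivity : 0 < 1 / a)).congr fun n => ?_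
    have : ∀ k : ℕ+, ‖∏ j ∈ Finset.range (n + 1),
        (if (-(k : ℤ) - (j : ℤ)) < 0 then ((1 / a : ℝ) : 𝕜) else (a : 𝕜))‖ = (1 / a) ^ (n + 1) := by
      intro k
      have hk := k.pos
      rw [Finset.prod_congr rfl fun j _ => if_pos (by omega), Finset.prod_const,
        Finset.card_range, norm_pow, RCLike.norm_ofReal, abs_of_pos (by positivity)]
    simp only [this, ciSup_const]
  · refine (tendsto_pow_succ_rpow ha0).congr fun n => ?_
    have : ∀ k : ℕ+, ‖∏ j ∈ Finset.range (n + 1),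
        (if ((k : ℤ) + (j : ℤ)) < 0 then ((1 / a : ℝ) : 𝕜) else (a : 𝕜))‖ = a ^ (n + 1) := by
      intro k
      rw [Finset.prod_congr rfl fun j _ => if_neg (by omega), Finset.prod_const,
        Finset.card_range, norm_pow, RCLike.norm_ofReal, abs_of_pos ha0]
    simp only [this, ciInf_const]

end Dichotomy

/-! ### Shifts on abstract sequence spaces -/

section SequenceSpace

variable {𝕜 X : Type*} [RCLike 𝕜] [NormedAddCommGroup X] [NormedSpace 𝕜 X]

variable (𝕜 X) in
/-- A presentation of `X` as a space of sequences indexed by `ℤ`, with the properties common to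
`ℓ_p(ℤ)` and `c_0(ℤ)`: coordinate functionals and unit vectors of norm at most one, density of the
finitely supported sequences, and boundedness of the multiplication operators composed with a
permutation of the indices. -/
structure SequenceSpace where
  /-- The coordinate functionals. -/
  coord : ℤ → X →L[𝕜] 𝕜
  /-- The unit vectors. -/
  single : ℤ → X
  ext : ∀ x y, (∀ n, coord n x = coord n y) → x = y
  norm_coord_le : ∀ n x, ‖coord n x‖ ≤ ‖x‖
  norm_single_le : ∀ n, ‖single n‖ ≤ 1
  coord_single : ∀ n m, coord n (single m) = if n = m then 1 else 0
  dense_span : Dense (Submodule.span 𝕜 (Set.range single) : Set X)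
  exists_mulComp : ∀ (u : ℤ → 𝕜) (σ : ℤ ≃ ℤ) (C : ℝ), 0 ≤ C → (∀ n, ‖u n‖ ≤ C) →
    ∃ A : X →L[𝕜] X, ‖A‖ ≤ C ∧ ∀ x n, coord n (A x) = u n * coord (σ n) x

namespace SequenceSpace

/-- `T` is the weighted backward shift with weights `w`, in terms of coordinates. -/
def IsWeightedShift (Φ : SequenceSpace 𝕜 X) (w : ℤ → 𝕜) (T : X ≃L[𝕜] X) : Prop :=
  ∀ x n, Φ.coord n (T x) = w (n + 1) * Φ.coord (n + 1) x

variable {Φ : SequenceSpace 𝕜 X} {w p : ℤ → 𝕜} {T : X ≃L[𝕜] X}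

/-- A dichotomy of the weight products yields a Green function of the shift: `G k` is `T ^ (k - 1)`
composed with the coordinate projection onto `E` for `k ≥ 1`, and minus `T ^ (k - 1)` composed with
the complementary projection for `k ≤ 0`. -/
theorem IsWeightedShift.exists_isGreenFunction (hT : Φ.IsWeightedShift w T)
    (hp : IsWeightProduct w p) {E : Set ℤ} (hE : HasDichotomy p E) :
    ∃ G, IsGreenFunction T G := by
  classical
  obtain ⟨C, r, hC, hr0, hr1, hin, hout⟩ := hE
  let s : ℤ → ℤ → 𝕜 := fun k j =>
    if 1 ≤ k then (if j ∈ E then 1 else 0) else (if j ∈ E then 0 else -1)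
  have hG : ∀ k : ℤ, ∃ A : X →L[𝕜] X, ‖A‖ ≤ C * r ^ (k - 1).natAbs ∧ ∀ x n, Φ.coord n (A x) =
      (p (n + (k - 1)) / p n * s k (n + (k - 1))) * Φ.coord (n + (k - 1)) x := by
    intro k
    refine Φ.exists_mulComp _ (Equiv.addRight (k - 1)) _ (by positivity) fun n => ?_
    have hpn : 0 < ‖p n‖ := norm_pos_iff.2 (hp.ne_zero n)
    have hz : (0 : ℝ) ≤ C * r ^ (k - 1).natAbs := by positivity
    rw [norm_mul, norm_div]
    by_cases hk : 1 ≤ k <;> by_cases hj : n + (k - 1) ∈ E <;>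
      simp only [s, hk, hj, if_true, if_false, norm_zero, mul_zero, norm_neg, norm_one, mul_one, hz]
    · rw [div_le_iff₀ hpn]
      have h := hin _ hj (k - 1).natAbs
      rwa [show n + (k - 1) - ((k - 1).natAbs : ℤ) = n by omega] at h
    · rw [div_le_iff₀ hpn]
      have h := hout _ hj (k - 1).natAbs
      rwa [show n + (k - 1) + ((k - 1).natAbs : ℤ) = n by omega] at h
  choose G hGn hGc using hG
  refine ⟨G, ?_, fun k x => Φ.ext _ _ fun n => ?_⟩
  · have hsum : Summable fun k : ℤ => r ^ (k - 1).natAbs :=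
      ((Equiv.subRight (1 : ℤ)).summable_iff (f := fun k : ℤ => r ^ k.natAbs)).2
        (summable_pow_natAbs hr0.le hr1)
    exact .of_nonneg_of_le (fun _ => norm_nonneg _) hGn (hsum.mul_left C)
  · have hs : s (k + 1) (n + k) = s k (n + k) + if k = 0 then 1 else 0 := by
      simp only [s]
      rcases lt_trichotomy k 0 with h | h | h
      · rw [if_neg (show ¬1 ≤ k + 1 by omega), if_neg (show ¬1 ≤ k by omega), if_neg h.ne,
          add_zero]
      · subst h
        rw [add_zero]
        by_cases hj : n ∈ E <;> simp [hj]
      · rw [if_pos (show 1 ≤ k + 1 by omega), if_pos (show 1 ≤ k by omega), if_neg h.ne', add_zero]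
    rw [map_add, hT, hGc, hGc, show n + (k + 1 - 1) = n + k by ring,
      show n + 1 + (k - 1) = n + k by ring, hs]
    have hw : w (n + 1) = p (n + 1) / p n := by rw [hp.succ, mul_div_cancel_right₀ _ (hp.ne_zero n)]
    have h1 := hp.ne_zero (n + 1)
    have h0 := hp.ne_zero n
    split_ifs with hk
    · subst hk
      rw [hw, add_zero]
      field_simp
    · rw [hw, map_zero, add_zero, add_zero]
      field_simp

/-- Shadowing forces a dichotomy of the weight products. A pseudotrajectory with errors
proportional to `e_{-n-1}` reduces the shadowing property to the existence of a real sequence `B`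
with `B i - B (i + 1) = δ * ‖p i‖` and `|B i| ≤ ‖p i‖`. Hence `B` decays geometrically where it is
positive, `-B` grows geometrically where it is positive, and at each index one of the two is
comparable to `‖p‖`. -/
theorem IsWeightedShift.exists_hasDichotomy (hT : Φ.IsWeightedShift w T)
    (hp : IsWeightProduct w p) (h : HasShadowingProperty T.toHomeomorph) :
    ∃ E, HasDichotomy p E := by
  obtain ⟨δ, hδ0, hδ1, hδ⟩ : ∃ δ : ℝ, 0 < δ ∧ δ < 1 ∧ ∀ x : ℤ → X,
      (∀ n : ℤ, dist (T.toHomeomorph (x n)) (x (n + 1)) ≤ δ) →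
      ∃ y : X, ∀ n : ℤ, dist (x n) ((T.toHomeomorph ^ n) y) < 1 := by
    obtain ⟨δ, hδ0, hδ⟩ := h 1 one_pos
    exact ⟨min δ (1 / 2), by positivity, (min_le_right _ _).trans_lt (by norm_num), fun x hx =>
      hδ x fun n => (hx n).trans (min_le_left _ _)⟩
  set c : ℤ → 𝕜 := fun i => ((δ * ‖p i‖ : ℝ) : 𝕜) / p i with hc
  have hcn : ∀ i, ‖c i‖ = δ := fun i => by
    have : ‖p i‖ ≠ 0 := norm_ne_zero_iff.2 (hp.ne_zero i)
    rw [hc, norm_div, RCLike.norm_ofReal, abs_of_nonneg (by positivity)]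
    field_simp
  obtain ⟨x, -, hx⟩ := exists_int_orbit
    (fun n => T.toEquiv.trans (Equiv.addRight (c (-n - 1) • Φ.single (-n - 1)))) (0 : X)
  replace hx : ∀ n, x (n + 1) = T (x n) + c (-n - 1) • Φ.single (-n - 1) := hx
  obtain ⟨y, hy⟩ := hδ x fun n => by
    rw [dist_comm, dist_eq_norm, hx]
    change ‖T (x n) + _ - T (x n)‖ ≤ δ
    rw [add_sub_cancel_left, norm_smul, hcn]
    exact mul_le_of_le_one_right hδ0.le (Φ.norm_single_le _)
  set d : ℤ → X := fun n => x n - (T.toHomeomorph ^ n) y with hd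
  have hdn : ∀ n, ‖d n‖ ≤ 1 := fun n => by rw [hd, ← dist_eq_norm]; exact (hy n).le
  have hds : ∀ n, d (n + 1) = T (d n) + c (-n - 1) • Φ.single (-n - 1) := fun n => by
    have : (T.toHomeomorph ^ (n + 1)) y = T ((T.toHomeomorph ^ n) y) := by
      rw [add_comm n, homeomorph_zpow_add_apply, zpow_one]; rfl
    simp only [hd]
    rw [hx, this, map_sub]
    abel
  set B : ℤ → ℝ := fun i => RCLike.re (p i * Φ.coord i (d (-i))) with hB
  have hBle : ∀ i, |B i| ≤ ‖p i‖ := fun i => by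
    refine (RCLike.abs_re_le_norm _).trans ?_
    rw [norm_mul]
    exact mul_le_of_le_one_right (norm_nonneg _) ((Φ.norm_coord_le _ _).trans (hdn _))
  have hBs : ∀ i, B i = B (i + 1) + δ * ‖p i‖ := fun i => by
    have e := hds (-(i + 1))
    rw [show -(i + 1) + 1 = -i by ring, show - -(i + 1) - 1 = i by ring] at e
    simp only [hB]
    rw [e, map_add, map_smul, hT, Φ.coord_single, if_pos rfl, smul_eq_mul, mul_one, mul_add, hc,
      mul_div_cancel₀ _ (hp.ne_zero i), map_add, RCLike.ofReal_re, hp.succ]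
    congr 2
    ring
  have hanti : Antitone B := antitone_int_of_succ_le fun i => by
    rw [hBs i]
    have := norm_nonneg (p i)
    nlinarith
  have hleft : ∀ (k : ℕ) (j : ℤ), 0 < B j → B j ≤ (1 - δ) ^ k * B (j - k) := by
    intro k
    induction k with
    | zero => intro j _; simp
    | succ k ih =>
      intro j hj
      have h1 := ih j hj
      have h2 := hBs (j - k - 1)
      have h3 := (le_abs_self _).trans (hBle (j - k - 1))
      rw [sub_add_cancel] at h2
      have h4 : B (j - k) ≤ (1 - δ) * B (j - k - 1) := by nlinarith
      have h5 : 0 ≤ (1 - δ) ^ k := pow_nonneg (by linarith) _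
      calc B j ≤ (1 - δ) ^ k * B (j - k) := h1
        _ ≤ (1 - δ) ^ k * ((1 - δ) * B (j - k - 1)) := by gcongr
        _ = (1 - δ) ^ (k + 1) * B (j - (k + 1 : ℕ)) := by
          push_cast
          rw [sub_sub]
          ring
  have hright : ∀ (k : ℕ) (j : ℤ), B j < 0 → (1 + δ) ^ k * -B j ≤ -B (j + k) := by
    intro k j hj
    induction k with
    | zero => simp
    | succ k ih =>
      have h2 := hBs (j + k)
      have h3 := (neg_le_abs _).trans (hBle (j + k))
      have h4 : (1 + δ) * -B (j + k) ≤ -B (j + k + 1) := by nlinarith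
      calc (1 + δ) ^ (k + 1) * -B j = (1 + δ) * ((1 + δ) ^ k * -B j) := by ring
        _ ≤ (1 + δ) * -B (j + k) := by gcongr
        _ ≤ -B (j + k + 1) := h4
        _ = _ := by push_cast; rw [add_assoc]
  -- Since `B j - B (j + 1) = δ * ‖p j‖`, off `E` one has `-B (j + 1) > δ / 2 * ‖p j‖`.
  refine ⟨{j | δ / 2 * ‖p j‖ ≤ B j}, 2 * (1 + δ) / δ, max (1 - δ) (1 + δ)⁻¹, by positivity,
    lt_max_of_lt_right (by positivity),
    max_lt (by linarith) (inv_lt_one_of_one_lt₀ (by linarith)), fun j hj k => ?_, fun j hj k => ?_⟩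
  · have hpj : 0 < ‖p j‖ := norm_pos_iff.2 (hp.ne_zero j)
    have hj' : δ / 2 * ‖p j‖ ≤ B j := hj
    have h1 := hleft k j (lt_of_lt_of_le (by positivity) hj')
    have h2 := (le_abs_self _).trans (hBle (j - k))
    have h3 : (1 - δ) ^ k ≤ max (1 - δ) (1 + δ)⁻¹ ^ k :=
      pow_le_pow_left₀ (by linarith) (le_max_left _ _) k
    have h4 : 0 ≤ (1 - δ) ^ k := pow_nonneg (by linarith) _
    have h5 : δ / 2 * ‖p j‖ ≤ max (1 - δ) (1 + δ)⁻¹ ^ k * ‖p (j - k)‖ := by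
      refine hj'.trans (h1.trans ?_)
      exact (mul_le_mul_of_nonneg_left h2 h4).trans (by gcongr)
    have h6 : (0 : ℝ) ≤ max (1 - δ) (1 + δ)⁻¹ ^ k * ‖p (j - k)‖ :=
      le_trans (by positivity) h5
    calc ‖p j‖ = 2 / δ * (δ / 2 * ‖p j‖) := by field_simp
      _ ≤ 2 / δ * (max (1 - δ) (1 + δ)⁻¹ ^ k * ‖p (j - k)‖) := by gcongr
      _ ≤ 2 * (1 + δ) / δ * (max (1 - δ) (1 + δ)⁻¹ ^ k * ‖p (j - k)‖) := by
        gcongr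
        linarith
      _ = _ := by ring
  · have hpj : 0 < ‖p j‖ := norm_pos_iff.2 (hp.ne_zero j)
    have hj' : B j < δ / 2 * ‖p j‖ := not_le.1 hj
    have hj1 : δ / 2 * ‖p j‖ < -B (j + 1) := by
      have := hBs j
      linarith
    have hk : ‖p j‖ ≤ 2 * (1 + δ) / δ * ((1 + δ)⁻¹ ^ k * ‖p (j + k)‖) := by
      rcases k with _ | k
      · have : 1 ≤ 2 * (1 + δ) / δ := by
          rw [one_le_div hδ0]; linarith
        simpa using le_mul_of_one_le_left hpj.le this
      · have hneg : B (j + 1) < 0 := by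
          have : 0 < δ / 2 * ‖p j‖ := by positivity
          linarith
        have h1 := hright k (j + 1) hneg
        have h2 := (neg_le_abs _).trans (hBle (j + 1 + k))
        rw [show j + ((k + 1 : ℕ) : ℤ) = j + 1 + k by push_cast; ring]
        have h3 : (1 + δ) ^ k * (δ / 2 * ‖p j‖) ≤ ‖p (j + 1 + k)‖ :=
          (mul_le_mul_of_nonneg_left hj1.le (by positivity)).trans (h1.trans h2)
        calc ‖p j‖ = 2 * (1 + δ) / δ * ((1 + δ)⁻¹ ^ (k + 1) * ((1 + δ) ^ k * (δ / 2 * ‖p j‖))) := by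
              rw [inv_pow, pow_succ]
              field_simp
          _ ≤ _ := by gcongr
    refine hk.trans ?_
    rw [mul_assoc]
    gcongr
    exact le_max_right _ _

end SequenceSpace

end SequenceSpace

/-! ### Eigenvalues and hyperbolicity -/

section Spectrum

variable {𝕜 X : Type*} [RCLike 𝕜] [NormedAddCommGroup X] [NormedSpace 𝕜 X]

theorem mem_spectrum_of_apply_eq_smul {T : X →L[𝕜] X} {c : 𝕜} {x : X} (hx : x ≠ 0)
    (h : T x = c • x) : c ∈ spectrum 𝕜 T := by
  rw [spectrum.mem_iff]
  rintro ⟨u, hu⟩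
  apply hx
  have h1 : (u : X →L[𝕜] X) x = 0 := by
    rw [hu, sub_apply, h, Algebra.algebraMap_eq_smul_one]
    simp
  calc x = ((↑u⁻¹ : X →L[𝕜] X) * (u : X →L[𝕜] X)) x := by rw [u.inv_mul]; rfl
    _ = 0 := by rw [mul_apply_eq_comp, h1, map_zero]

theorem one_mem_complexifiedSpectrum {T : X →L[𝕜] X} {x : X} (hx : x ≠ 0) (h : T x = x) :
    1 ∈ complexifiedSpectrum T := by
  let _ : Module ℝ X := Module.compHom X (algebraMap ℝ 𝕜)
  have _ : IsScalarTower ℝ 𝕜 X := .of_algebraMap_smul fun _ _ => rfl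
  change (1 : ℂ) ∈ spectrum ℂ
    (((T : X →ₗ[𝕜] X).restrictScalars ℝ).baseChange ℂ : Module.End ℂ (ℂ ⊗[ℝ] X))
  rw [spectrum.mem_iff, map_one]
  rintro ⟨u, hu⟩
  have h1 : (u : Module.End ℂ (ℂ ⊗[ℝ] X)) (1 ⊗ₜ[ℝ] x) = 0 := by
    rw [hu, LinearMap.sub_apply, LinearMap.baseChange_tmul]
    change (1 : ℂ) ⊗ₜ[ℝ] x - (1 : ℂ) ⊗ₜ[ℝ] (T x) = 0
    rw [h, sub_self]
  have h2 : (1 : ℂ) ⊗ₜ[ℝ] x = 0 := by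
    calc (1 : ℂ) ⊗ₜ[ℝ] x = ((↑u⁻¹ : Module.End ℂ (ℂ ⊗[ℝ] X)) * u) (1 ⊗ₜ[ℝ] x) := by
          rw [u.inv_mul]; rfl
      _ = 0 := by rw [Module.End.mul_apply, h1, map_zero]
  apply hx
  apply Module.FaithfullyFlat.tensorProduct_mk_injective (A := ℝ) (B := ℂ) X
  simpa using h2

/-- An operator with a nonzero fixed point is not hyperbolic. -/
theorem not_isHyperbolic_of_fixed {T : X →L[𝕜] X} {x : X} (hx : x ≠ 0) (h : T x = x) :
    ¬ IsHyperbolic T := by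
  rintro ⟨h1, h2⟩
  by_cases hI : (RCLike.I : 𝕜) = 0
  · exact Set.disjoint_left.1 (h2 hI) (one_mem_complexifiedSpectrum hx h) (by simp)
  · exact Set.disjoint_left.1 (h1 hI)
      (mem_spectrum_of_apply_eq_smul (c := 1) hx (by rw [h, one_smul])) (by simp)

/-! ### Failure of structural stability relative to `GL(X)` -/

/-- Near the largest element of the real spectrum the resolvent is unbounded, so that the dual of
`T` has approximate eigenvectors; a small perturbation of `T` by an operator of rank one makes one
of them exact. -/
theorem exists_near_with_dual_eigenvector [CompleteSpace X] {T : X →L[𝕜] X} {l : ℝ}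
    (hl : (l : 𝕜) ∈ spectrum 𝕜 T) {ε : ℝ} (hε : 0 < ε) :
    ∃ (S : X →L[𝕜] X) (g : X →L[𝕜] 𝕜) (t : ℝ), ‖S - T‖ ≤ ε ∧ g ≠ 0 ∧ l < t ∧
      ∀ x, g (S x) = t * g x := by
  set s : Set ℝ := {t | l ≤ t ∧ (t : 𝕜) ∈ spectrum 𝕜 T} with hs
  have hclosed : IsClosed s :=
    isClosed_Ici.inter ((spectrum.isClosed T).preimage RCLike.continuous_ofReal)
  have hbdd : BddAbove s := by
    refine ⟨‖T‖ * ‖(1 : X →L[𝕜] X)‖, fun t ht => ?_⟩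
    have := spectrum.norm_le_norm_mul_of_mem ht.2
    rw [RCLike.norm_ofReal] at this
    exact (le_abs_self t).trans this
  set m := sSup s
  have hm : m ∈ s := hclosed.csSup_mem ⟨l, le_rfl, hl⟩ hbdd
  obtain ⟨η, hη0, hη⟩ : ∃ η : ℝ, 0 < η ∧ 2 * η ≤ ε := ⟨ε / 2, by positivity, by linarith⟩
  have hlt : l < m + η := by linarith [hm.1]
  have hres : ((m + η : ℝ) : 𝕜) ∉ spectrum 𝕜 T := fun h =>
    absurd (le_csSup hbdd ⟨hlt.le, h⟩) (by linarith)
  obtain ⟨u, hu⟩ := spectrum.notMem_iff.1 hres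
  have hsub : algebraMap 𝕜 (X →L[𝕜] X) (m : 𝕜) - T - u = -(η : 𝕜) • (1 : X →L[𝕜] X) := by
    rw [hu, Algebra.algebraMap_eq_smul_one, Algebra.algebraMap_eq_smul_one]
    push_cast
    module
  have hnorm : ‖algebraMap 𝕜 (X →L[𝕜] X) (m : 𝕜) - T - u‖ ≤ η := by
    rw [hsub, norm_smul, norm_neg, RCLike.norm_ofReal, abs_of_pos hη0]
    exact mul_le_of_le_one_right hη0.le ContinuousLinearMap.norm_id_le
  have hinv : ‖(↑u⁻¹ : X →L[𝕜] X)‖⁻¹ ≤ η := by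
    by_contra! h
    exact spectrum.mem_iff.1 hm.2 (Units.ofNearby u _ (hnorm.trans_lt h)).isUnit
  have hpos : 0 < ‖(↑u⁻¹ : X →L[𝕜] X)‖ := by
    refine norm_pos_iff.2 fun h0 => ?_
    have h1 : (1 : X →L[𝕜] X) = 0 := by rw [← u.inv_mul, h0, zero_mul]
    refine spectrum.mem_iff.1 hm.2 ?_
    rw [isUnit_iff_exists]
    exact ⟨0, by rw [mul_zero, h1], by rw [zero_mul, h1]⟩
  obtain ⟨x, hx⟩ := ContinuousLinearMap.exists_mul_lt_of_lt_opNorm (↑u⁻¹ : X →L[𝕜] X)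
    (r := (2 * η)⁻¹) (by positivity) (by
      have h1 : η⁻¹ ≤ ‖(↑u⁻¹ : X →L[𝕜] X)‖ := inv_le_of_inv_le₀ hpos hinv
      have h2 : (2 * η)⁻¹ < η⁻¹ := by
        apply inv_strictAnti₀ hη0; linarith
      exact h2.trans_le h1)
  set y := (↑u⁻¹ : X →L[𝕜] X) x with hy
  have hy0 : 0 < ‖y‖ := lt_of_le_of_lt (by positivity) hx
  obtain ⟨f, hf, hfy⟩ := exists_dual_vector 𝕜 y hy0.ne'
  set g : X →L[𝕜] 𝕜 := f.comp (↑u⁻¹ : X →L[𝕜] X) with hg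
  have hgx : g x = (‖y‖ : 𝕜) := hfy
  have hgT : ∀ z, g (T z) = ((m + η : ℝ) : 𝕜) * g z - f z := fun z => by
    have h1 : g ((u : X →L[𝕜] X) z) = f z := by
      rw [hg, ContinuousLinearMap.comp_apply, ← mul_apply_eq_comp, u.inv_mul]
      rfl
    rw [hu, sub_apply, Algebra.algebraMap_eq_smul_one,
      smul_apply, map_sub, map_smul] at h1
    rw [← h1]
    simp
  have hy0' : (‖y‖ : 𝕜) ≠ 0 := RCLike.ofReal_ne_zero.2 hy0.ne'
  set v : X := (‖y‖ : 𝕜)⁻¹ • x with hv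
  have hgv : g v = 1 := by rw [hv, map_smul, hgx, smul_eq_mul, inv_mul_cancel₀ hy0']
  refine ⟨T + f.smulRight v, g, m + η, ?_, fun h => ?_, hlt, fun z => ?_⟩
  · rw [add_sub_cancel_left, ContinuousLinearMap.norm_smulRight_apply, hf, one_mul, hv, norm_smul,
      norm_inv, RCLike.norm_ofReal, abs_of_pos hy0, inv_mul_le_iff₀ hy0]
    rw [inv_mul_lt_iff₀ (by positivity)] at hx
    nlinarith
  · rw [h] at hgv
    simp at hgv
  · rw [add_apply, map_add, hgT, ContinuousLinearMap.smulRight_apply, map_smul,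
      hgv, smul_eq_mul]
    ring

/-- If the points with convergent forward orbit are dense and the spectrum contains a real number
larger than one, then `T` is not structurally stable relative to `GL(X)`: a nearby operator has a
functional `g` with `g ∘ S = t • g` and `t > 1`, and the points with convergent `S`-orbit lie in
the kernel of `g`. -/
theorem not_structurallyStableRelGL [CompleteSpace X] {T : X ≃L[𝕜] X} {l : ℝ} (hl1 : 1 < l)
    (hl : (l : 𝕜) ∈ spectrum 𝕜 (T : X →L[𝕜] X))
    (hd : Dense {x : X | ∃ y, Tendsto (fun n : ℕ => T^[n] x) atTop (𝓝 y)}) :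
    ¬ StructurallyStableRelGL T := by
  rintro ⟨ε, hε, hst⟩
  set τ := ContinuousLinearEquiv.toUnit T with hτ
  obtain ⟨S₀, g, t, hS₀, hg, hlt, hgS⟩ : ∃ (S : X →L[𝕜] X) (g : X →L[𝕜] 𝕜) (t : ℝ),
      (‖S - T‖ ≤ ε ∧ ‖S - τ‖ < ‖(↑τ⁻¹ : X →L[𝕜] X)‖⁻¹) ∧ g ≠ 0 ∧ l < t ∧
      ∀ x, g (S x) = t * g x := by
    have hpos : 0 < ‖(↑τ⁻¹ : X →L[𝕜] X)‖⁻¹ := by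
      refine inv_pos.2 (norm_pos_iff.2 fun h0 => ?_)
      have h1 : (1 : X →L[𝕜] X) = 0 := by rw [← τ.inv_mul, h0, zero_mul]
      refine spectrum.mem_iff.1 hl ?_
      rw [isUnit_iff_exists]
      exact ⟨0, by rw [mul_zero, h1], by rw [zero_mul, h1]⟩
    obtain ⟨S, g, t, h1, h2, h3, h4⟩ := exists_near_with_dual_eigenvector hl
      (lt_min hε (half_pos hpos))
    exact ⟨S, g, t, ⟨h1.trans (min_le_left _ _),
      (h1.trans (min_le_right _ _)).trans_lt (half_lt_self hpos)⟩, h2, h3, h4⟩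
  set S : X ≃L[𝕜] X := ContinuousLinearEquiv.ofUnit (Units.ofNearby τ S₀ hS₀.2) with hS
  have hSS : (S : X →L[𝕜] X) = S₀ := rfl
  obtain ⟨h, hh⟩ := hst S (by rw [hSS]; exact hS₀.1)
  have hiter : ∀ (n : ℕ) x, h (S^[n] x) = T^[n] (h x) := fun n x =>
    (Function.Semiconj.iterate_right (f := h) (ga := S) (gb := T) hh n) x
  have hgiter : ∀ (n : ℕ) x, g (S^[n] x) = (t : 𝕜) ^ n * g x := fun n x => by
    induction n with
    | zero => simp
    | succ n ih =>
      rw [Function.iterate_succ_apply', pow_succ', mul_assoc, ← ih]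
      exact hgS _
  have hker : h ⁻¹' {x : X | ∃ y, Tendsto (fun n : ℕ => T^[n] x) atTop (𝓝 y)} ⊆ {x | g x = 0} := by
    rintro x ⟨y, hy⟩
    by_contra hgx
    have h1 : Tendsto (fun n : ℕ => S^[n] x) atTop (𝓝 (h.symm y)) := by
      refine ((h.symm.continuous.tendsto y).comp hy).congr fun n => ?_
      rw [Function.comp_apply, ← hiter, Homeomorph.symm_apply_apply]
    have h2 := ((g.continuous.tendsto _).comp h1).norm
    have h3 : Tendsto (fun n : ℕ => t ^ n * ‖g x‖) atTop atTop :=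
      (tendsto_pow_atTop_atTop_of_one_lt (hl1.trans hlt)).atTop_mul_const (norm_pos_iff.2 hgx)
    refine not_tendsto_nhds_of_tendsto_atTop h3 _ (h2.congr fun n => ?_)
    rw [Function.comp_apply, hgiter, norm_mul, norm_pow, RCLike.norm_ofReal,
      abs_of_pos (by linarith)]
  have hclosed : IsClosed {x | g x = 0} := isClosed_eq g.continuous continuous_const
  have hdense : Dense {x | g x = 0} := (hd.preimage h.isOpenMap).mono hker
  apply hg
  ext x
  have : x ∈ {x | g x = 0} := by rw [← hclosed.closure_eq]; exact hdense x
  simpa using this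

end Spectrum

/-! ### Eigenvectors and convergent orbits of weighted shifts -/

namespace SequenceSpace

variable {𝕜 X : Type*} [RCLike 𝕜] [NormedAddCommGroup X] [NormedSpace 𝕜 X]
variable {Φ : SequenceSpace 𝕜 X} {w p : ℤ → 𝕜} {T : X ≃L[𝕜] X}

theorem IsWeightedShift.exists_eigenvector [CompleteSpace X] (hT : Φ.IsWeightedShift w T)
    (hp : IsWeightProduct w p) {t : ℝ} (ht : 1 ≤ t)
    (hs : Summable fun n : ℤ => ‖(t : 𝕜) ^ n / p n‖) : ∃ x : X, x ≠ 0 ∧ T x = (t : 𝕜) • x := by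
  have ht0 : (t : 𝕜) ≠ 0 := RCLike.ofReal_ne_zero.2 (by linarith)
  have hsum : Summable fun n : ℤ => ((t : 𝕜) ^ n / p n) • Φ.single n := by
    refine .of_norm_bounded hs fun n => ?_
    rw [norm_smul]
    exact mul_le_of_le_one_right (norm_nonneg _) (Φ.norm_single_le n)
  have hc : ∀ m, Φ.coord m (∑' n : ℤ, ((t : 𝕜) ^ n / p n) • Φ.single n) = (t : 𝕜) ^ m / p m := by
    intro m
    rw [(Φ.coord m).map_tsum hsum, tsum_eq_single m]
    · rw [map_smul, Φ.coord_single, if_pos rfl, smul_eq_mul, mul_one]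
    · intro n hn
      rw [map_smul, Φ.coord_single, if_neg hn.symm, smul_zero]
  refine ⟨∑' n : ℤ, ((t : 𝕜) ^ n / p n) • Φ.single n, fun h0 => ?_, Φ.ext _ _ fun n => ?_⟩
  · have := hc 0
    rw [h0, map_zero] at this
    exact div_ne_zero (zpow_ne_zero _ ht0) (hp.ne_zero 0) this.symm
  · have h0 := hp.ne_zero n
    have h1 := hp.ne_zero (n + 1)
    rw [hT, map_smul, hc, hc, smul_eq_mul, zpow_add_one₀ ht0]
    rw [hp.succ] at h1 ⊢
    have h2 := left_ne_zero_of_mul h1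
    field_simp

/-- The forward orbits of all finitely supported sequences converge to zero. -/
theorem IsWeightedShift.dense_convergent (hT : Φ.IsWeightedShift w T) (hp : IsWeightProduct w p)
    (hs : Summable fun n : ℤ => ‖(p n)⁻¹‖) :
    Dense {x : X | ∃ y, Tendsto (fun n : ℕ => T^[n] x) atTop (𝓝 y)} := by
  have hTs : ∀ (k : ℕ) (m : ℤ), T^[k] (Φ.single m) = (p m / p (m - k)) • Φ.single (m - k) := by
    intro k m
    induction k with
    | zero => simp [hp.ne_zero m]
    | succ k ih =>
      rw [Function.iterate_succ_apply', ih]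
      refine Φ.ext _ _ fun n => ?_
      rw [hT, map_smul, map_smul, Φ.coord_single, Φ.coord_single, smul_eq_mul, smul_eq_mul]
      push_cast
      by_cases hn : n + 1 = m - k
      · have h1 : n = m - (k + 1) := by omega
        rw [if_pos hn, if_pos h1, ← h1, ← hn]
        have h2 := hp.ne_zero n
        have h3 := hp.ne_zero (n + 1)
        rw [hp.succ] at h3 ⊢
        have h4 := left_ne_zero_of_mul h3
        field_simp
      · rw [if_neg hn, if_neg (by omega)]
        simp
  refine Φ.dense_span.mono fun x hx => ⟨0, ?_⟩
  induction hx using Submodule.span_induction with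
  | mem x hx =>
    obtain ⟨m, rfl⟩ := hx
    have hinj : Function.Injective fun k : ℕ => m - (k : ℤ) := fun a b h => by
      simp only at h; omega
    have h1 := (hs.tendsto_cofinite_zero.comp hinj.tendsto_cofinite).const_mul ‖p m‖
    rw [Nat.cofinite_eq_atTop, mul_zero] at h1
    refine squeeze_zero_norm (fun k => ?_) h1
    rw [hTs, norm_smul, div_eq_mul_inv, norm_mul]
    exact mul_le_of_le_one_right (by positivity) (Φ.norm_single_le _)
  | zero =>
    refine tendsto_const_nhds.congr fun k => ?_
    exact (Function.iterate_fixed (map_zero T) k).symm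
  | add x y _ _ hx hy =>
    have := hx.add hy
    rw [add_zero] at this
    exact this.congr fun k => (iterate_map_add T k x y).symm
  | smul c x _ hx =>
    have := hx.const_smul c
    rw [smul_zero] at this
    exact this.congr fun k =>
      ((Function.Semiconj.iterate_right (f := fun z : X => c • z) (ga := T) (gb := T)
        (fun z => (map_smul T c z).symm) k) x)

theorem IsWeightedShift.structurallyStable_of_shadowing [CompleteSpace X]
    (hT : Φ.IsWeightedShift w T) (hw : ∀ n, w n ≠ 0)
    (h : HasShadowingProperty T.toHomeomorph) : StructurallyStable T := by
  obtain ⟨p, hp⟩ := exists_isWeightProduct hw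
  obtain ⟨E, hE⟩ := hT.exists_hasDichotomy hp h
  obtain ⟨G, hG⟩ := hT.exists_isGreenFunction hp hE
  exact hG.structurallyStable

theorem IsWeightedShift.of_conditionC [CompleteSpace X] (hT : Φ.IsWeightedShift w T)
    (hw : IsInvertibleWeight w) (h : ConditionC w) :
    StructurallyStable T ∧ ¬ IsHyperbolic (T : X →L[𝕜] X) ∧ ¬ StructurallyStableRelGL T := by
  obtain ⟨p, hp⟩ := exists_isWeightProduct hw.ne_zero
  have hE := h.hasDichotomy hw hp
  obtain ⟨G, hG⟩ := hT.exists_isGreenFunction hp hE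
  obtain ⟨l, hl1, hl⟩ := hE.exists_summable_zpow_div hp
  obtain ⟨x, hx0, hx⟩ := hT.exists_eigenvector hp le_rfl (hl 1 le_rfl hl1)
  obtain ⟨t, ht1, htl⟩ := exists_between hl1
  obtain ⟨y, hy0, hy⟩ := hT.exists_eigenvector hp ht1.le (hl t ht1.le htl)
  refine ⟨hG.structurallyStable,
    not_isHyperbolic_of_fixed hx0 (hx.trans (by rw [RCLike.ofReal_one, one_smul])),
    not_structurallyStableRelGL ht1 (mem_spectrum_of_apply_eq_smul hy0 hy)
      (hT.dense_convergent hp ?_)⟩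
  simpa using hl 1 le_rfl hl1

end SequenceSpace

/-! ### The spaces `ℓ_p(ℤ)` and `c_0(ℤ)` -/

section Models

variable {𝕜 : Type*} [RCLike 𝕜]

theorem norm_lpMulComp_le (p : ℝ≥0∞) [Fact (1 ≤ p)] (hp : p ≠ ∞) (u : ℤ → 𝕜) (σ : ℤ ≃ ℤ)
    {C : ℝ} (hC0 : 0 ≤ C) (hC : ∀ n, ‖u n‖ ≤ C) :
    ‖lpMulComp p hp u σ ⟨C, hC0, hC⟩‖ ≤ C := by
  have hp0 : 0 < p.toReal := ENNReal.toReal_pos (zero_lt_one.trans_le Fact.out).ne' hp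
  refine ContinuousLinearMap.opNorm_le_bound _ hC0 fun x => ?_
  have hs : Summable fun n => C ^ p.toReal * ‖x (σ n)‖ ^ p.toReal :=
    ((σ.summable_iff (f := fun n => ‖x n‖ ^ p.toReal)).2 ((lp.memℓp x).summable hp0)).mul_left _
  refine lp.norm_le_of_forall_sum_le hp0 (mul_nonneg hC0 (norm_nonneg _)) fun s => ?_
  calc ∑ n ∈ s, ‖lpMulComp p hp u σ ⟨C, hC0, hC⟩ x n‖ ^ p.toReal
      ≤ ∑ n ∈ s, C ^ p.toReal * ‖x (σ n)‖ ^ p.toReal := Finset.sum_le_sum fun n _ => by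
        change ‖u n * x (σ n)‖ ^ p.toReal ≤ _
        rw [norm_mul, Real.mul_rpow (norm_nonneg _) (norm_nonneg _)]
        gcongr
        exact hC n
    _ ≤ ∑' n, C ^ p.toReal * ‖x (σ n)‖ ^ p.toReal := hs.sum_le_tsum s fun n _ => by positivity
    _ = (C * ‖x‖) ^ p.toReal := by
        rw [tsum_mul_left, σ.tsum_eq (fun n => ‖x n‖ ^ p.toReal), ← lp.norm_rpow_eq_tsum hp0,
          Real.mul_rpow hC0 (norm_nonneg _)]

variable (𝕜) in
/-- `ℓ_p(ℤ)` as a sequence space. -/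
def lpSequenceSpace (p : ℝ≥0∞) [Fact (1 ≤ p)] (hp : p ≠ ∞) :
    SequenceSpace 𝕜 (lp (fun _ : ℤ => 𝕜) p) where
  coord n := lp.evalCLM 𝕜 (fun _ : ℤ => 𝕜) p n
  single n := lp.single p n 1
  ext x y h := by ext n; exact h n
  norm_coord_le n x := lp.norm_apply_le_norm (zero_lt_one.trans_le Fact.out).ne' x n
  norm_single_le n := by
    rw [lp.norm_single (zero_lt_one.trans_le Fact.out), norm_one]
  coord_single n m := by
    change lp.single (E := fun _ : ℤ => 𝕜) p m 1 n = _
    split_ifs with h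
    · subst h; exact lp.single_apply_self p n 1
    · exact lp.single_apply_ne p m 1 h
  dense_span x := by
    refine mem_closure_of_tendsto (lp.hasSum_single hp x) (Eventually.of_forall fun s => ?_)
    refine Submodule.sum_mem _ fun n _ => ?_
    have : lp.single p n (x n) = x n • lp.single (E := fun _ : ℤ => 𝕜) p n 1 := by
      rw [← lp.single_smul, smul_eq_mul, mul_one]
    rw [this]
    exact Submodule.smul_mem _ _ (Submodule.subset_span ⟨n, rfl⟩)
  exists_mulComp u σ C hC0 hC :=
    ⟨lpMulComp p hp u σ ⟨C, hC0, hC⟩, norm_lpMulComp_le p hp u σ hC0 hC, fun _ _ => rfl⟩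

theorem ZeroAtInftyContinuousMap.norm_apply_le (x : C₀(ℤ, 𝕜)) (n : ℤ) : ‖x n‖ ≤ ‖x‖ := by
  rw [← ZeroAtInftyContinuousMap.norm_toBCF_eq_norm]
  exact x.toBCF.norm_coe_le_norm n

theorem ZeroAtInftyContinuousMap.norm_le_of_forall {x : C₀(ℤ, 𝕜)} {C : ℝ} (hC : 0 ≤ C)
    (h : ∀ n, ‖x n‖ ≤ C) : ‖x‖ ≤ C := by
  rw [← ZeroAtInftyContinuousMap.norm_toBCF_eq_norm, BoundedContinuousFunction.norm_le hC]
  exact h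

variable (𝕜) in
/-- The coordinate functionals on `c_0(ℤ)`. -/
def c0Coord (n : ℤ) : C₀(ℤ, 𝕜) →L[𝕜] 𝕜 :=
  LinearMap.mkContinuous
    { toFun := fun x => x n
      map_add' := fun _ _ => rfl
      map_smul' := fun _ _ => rfl } 1 fun x => by
    rw [one_mul]
    exact ZeroAtInftyContinuousMap.norm_apply_le x n

variable (𝕜) in
/-- The unit vectors of `c_0(ℤ)`. -/
def c0Single (m : ℤ) : C₀(ℤ, 𝕜) where
  toFun := fun n => if n = m then 1 else 0
  continuous_toFun := continuous_of_discreteTopology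
  zero_at_infty' := by
    rw [cocompact_eq_cofinite]
    refine tendsto_const_nhds.congr' ?_
    filter_upwards [(Set.finite_singleton m).compl_mem_cofinite] with n hn
    exact (if_neg hn).symm

variable (𝕜) in
/-- `c_0(ℤ)` as a sequence space. -/
def c0SequenceSpace : SequenceSpace 𝕜 C₀(ℤ, 𝕜) where
  coord := c0Coord 𝕜
  single := c0Single 𝕜
  ext x y h := by ext n; exact h n
  norm_coord_le n x := ZeroAtInftyContinuousMap.norm_apply_le x n
  norm_single_le m := ZeroAtInftyContinuousMap.norm_le_of_forall zero_le_one fun n => by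
    change ‖(if n = m then 1 else 0 : 𝕜)‖ ≤ 1
    split_ifs <;> simp
  coord_single _ _ := rfl
  dense_span x := by
    refine Metric.mem_closure_iff.2 fun ε hε => ?_
    -- Truncate `x` to the finite set where its entries are not small.
    have hx := zero_at_infty x
    rw [cocompact_eq_cofinite] at hx
    have hfin : {n | ¬ ‖x n‖ < ε / 2}.Finite := by
      have := hx.norm.eventually_lt_const (show ‖(0 : 𝕜)‖ < ε / 2 by simpa using hε)
      exact eventually_cofinite.1 this
    refine ⟨∑ n ∈ hfin.toFinset, x n • c0Single 𝕜 n, Submodule.sum_mem _ fun n _ =>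
      Submodule.smul_mem _ _ (Submodule.subset_span ⟨n, rfl⟩), ?_⟩
    rw [dist_eq_norm]
    refine lt_of_le_of_lt (ZeroAtInftyContinuousMap.norm_le_of_forall (by positivity) fun n => ?_)
      (half_lt_self hε)
    have hc : c0Coord 𝕜 n (∑ m ∈ hfin.toFinset, x m • c0Single 𝕜 m) =
        if n ∈ hfin.toFinset then x n else 0 := by
      rw [map_sum]
      have : ∀ m, c0Coord 𝕜 n (x m • c0Single 𝕜 m) = if n = m then x m else 0 := fun m => by
        rw [map_smul]
        change x m • (if n = m then 1 else 0 : 𝕜) = _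
        split_ifs <;> simp
      simp only [this, Finset.sum_ite_eq]
    change ‖x n - c0Coord 𝕜 n (∑ m ∈ hfin.toFinset, x m • c0Single 𝕜 m)‖ ≤ _
    rw [hc]
    split_ifs with h
    · rw [sub_self, norm_zero]
      positivity
    · rw [sub_zero]
      rw [Set.Finite.mem_toFinset, Set.mem_ofPred_eq, not_not] at h
      exact h.le
  exists_mulComp u σ C hC0 hC := by
    refine ⟨c0MulComp u σ ⟨C, hC0, hC⟩, ContinuousLinearMap.opNorm_le_bound _ hC0 fun x =>
      ZeroAtInftyContinuousMap.norm_le_of_forall (mul_nonneg hC0 (norm_nonneg _)) fun n => ?_,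
      fun _ _ => rfl⟩
    change ‖u n * x (σ n)‖ ≤ _
    rw [norm_mul]
    exact mul_le_mul (hC n) (ZeroAtInftyContinuousMap.norm_apply_le x _) (norm_nonneg _) hC0

end Models

end

theorem theorem3p9 {𝕜 : Type*} [RCLike 𝕜] :
    (∀ (w : ℤ → 𝕜) (hw : IsInvertibleWeight w),
      (∀ (p : ℝ≥0∞) [Fact (1 ≤ p)] (hp : p ≠ ∞),
        (HasShadowingProperty (lpShift p hp w hw).toHomeomorph →
          StructurallyStable (lpShift p hp w hw)) ∧
        (ConditionC w →
          StructurallyStable (lpShift p hp w hw) ∧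
          ¬ IsHyperbolic (lpShift p hp w hw : lp (fun _ : ℤ => 𝕜) p →L[𝕜] lp (fun _ : ℤ => 𝕜) p) ∧
          ¬ StructurallyStableRelGL (lpShift p hp w hw))) ∧
      (HasShadowingProperty (c0Shift w hw).toHomeomorph →
        StructurallyStable (c0Shift w hw)) ∧
      (ConditionC w →
        StructurallyStable (c0Shift w hw) ∧
        ¬ IsHyperbolic (c0Shift w hw : C₀(ℤ, 𝕜) →L[𝕜] C₀(ℤ, 𝕜)) ∧
        ¬ StructurallyStableRelGL (c0Shift w hw))) ∧
    (∀ a : ℝ, 1 < a →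
      IsInvertibleWeight (fun n : ℤ => if n < 0 then ((1 / a : ℝ) : 𝕜) else (a : 𝕜)) ∧
      ConditionC (fun n : ℤ => if n < 0 then ((1 / a : ℝ) : 𝕜) else (a : 𝕜))) := by
  refine ⟨fun w hw => ⟨fun p _ hp => ?_, ?_, ?_⟩, fun a ha =>
    ⟨isInvertibleWeight_ite ha, conditionC_ite ha⟩⟩
  · have hT : (lpSequenceSpace 𝕜 p hp).IsWeightedShift w (lpShift p hp w hw) := fun _ _ => rfl
    exact ⟨hT.structurallyStable_of_shadowing hw.ne_zero, hT.of_conditionC hw⟩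
  · have hT : (c0SequenceSpace 𝕜).IsWeightedShift w (c0Shift w hw) := fun _ _ => rfl
    exact hT.structurallyStable_of_shadowing hw.ne_zero
  · have hT : (c0SequenceSpace 𝕜).IsWeightedShift w (c0Shift w hw) := fun _ _ => rfl
    exact hT.of_conditionC hw
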